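/- For a finite-dimensional real vector space $V$, call a convex cone $\mathsf{C}\subset V$ proper if it is closed, contains $0$, does not contain any line, and is not contained in any hyperplane, and let $\mathsf{C}^*=\{f\in V^* : f(x)\ge 0 \text{ for all } x\in\mathsf{C}\}$ be its dual cone. For proper cones $\mathsf{C}_A\subset V_A$ and $\mathsf{C}_B\subset V_B$ let \[ \mathsf{C}_A\otimes_{\min}\mathsf{C}_B=\operatorname{conv}\{x\otimes y : x\in\mathsf{C}_A,\ y\in\mathsf{C}_B\}\subset V_A\otimes V_B, \] \[ \mathsf{C}_A\otimes_{\max}\mathsf{C}_B=\{z\in V_A\otimes V_B : (f\otimes g)(z)\ge 0 \text{ for all } f\in\mathsf{C}_A^*,\ g\in\mathsf{C}_B^*\}, \] and let $\mathsf{C}_B^{\otimes_{\max}k}\subset V_B^{\otimes k}$ be the $k$-fold maximal tensor product, i.e. the set of all $z\in V_B^{\otimes k}$ with $(f_1\otimes\cdots\otimes f_k)(z)\ge 0$ for all $f_1,\dots,f_k\in\mathsf{C}_B^*$. Theorem 1. Let $V_A$ and $V_B$ be finite-dimensional real vector spaces, let $\mathsf{C}_A\subset V_A$ and $\mathsf{C}_B\subset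 V_B$ be proper cones, and let $\phi\in V_B^*$ be a linear form in the interior of $\mathsf{C}_B^*$. Then \[ \mathsf{C}_A\otimes_{\min}\mathsf{C}_B=\bigcap_{k\ge 1}\left(\mathrm{Id}_{V_A}\otimes\gamma_k^\phi\right)\left(\mathsf{C}_A\otimes_{\max}\mathsf{C}_B^{\otimes_{\max}k}\right), \] where, for an integer $k\ge 1$, the $k$th reduction map $\gamma_k^\phi:V_B^{\otimes k}\to V_B$ is \[ \gamma_k^\phi=\frac1k\sum_{j=1}^k\phi^{\otimes(j-1)}\otimes\mathrm{Id}_{V_B}\otimes\phi^{\otimes(k-j)}. \] -/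

import Mathlib

open scoped TensorProduct

namespace ConeMonogamy

open Module

section Definitions

variable {V : Type*} [NormedAddCommGroup V] [NormedSpace ℝ V]

/-- A convex cone (a pointed cone, so `0` belongs to it) is *proper* if it is closed, contains no
line, and is contained in no hyperplane. In finite dimension the norm only serves to name the
unique Hausdorff vector space topology. -/
structure IsProper (C : PointedCone ℝ V) : Prop where
  isClosed : IsClosed (C : Set V)
  no_line : ∀ x ∈ C, -x ∈ C → x = 0
  no_hyperplane : ∀ f : Dual ℝ V, f ≠ 0 → ∃ x ∈ C, f x ≠ 0

/-- The dual cone `C*`, as a subset of the normed space of continuous linear forms (in finite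
dimension: of all linear forms); it is used where the topology of the dual space matters. -/
def dualCone (C : PointedCone ℝ V) : Set (StrongDual ℝ V) :=
  {f | ∀ x ∈ C, 0 ≤ f x}

end Definitions

section Algebra

variable {V : Type*} [AddCommGroup V] [Module ℝ V]

/-- The `k`-fold minimal tensor product `C ⊗_min ⋯ ⊗_min C`, generated by the elementary tensors
of elements of `C`. -/
noncomputable def minPower (C : PointedCone ℝ V) (k : ℕ) : PointedCone ℝ (⨂[ℝ]^k V) :=
  .hull ℝ {z | ∃ x : Fin k → V, (∀ i, x i ∈ C) ∧ z = PiTensorProduct.tprod ℝ x}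

/-- The `k`-fold maximal tensor product `C ⊗_max ⋯ ⊗_max C`, the dual of the `k`-fold minimal
tensor product of the dual cone. -/
noncomputable def maxPower (C : PointedCone ℝ V) (k : ℕ) : PointedCone ℝ (⨂[ℝ]^k V) :=
  .dual PiTensorProduct.dualDistrib (minPower (.dual (Dual.eval ℝ V) (C : Set V)) k)

lemma slot_aux (φ : Dual ℝ V) {k : ℕ} (j i : Fin k) (x : Fin k → V) (v : V) :
    (∏ l ∈ Finset.univ.erase j, φ (Function.update x i v l)) • Function.update x i v j =
      if i = j then (∏ l ∈ Finset.univ.erase j, φ (x l)) • v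
      else (φ v * ∏ l ∈ (Finset.univ.erase j).erase i, φ (x l)) • x j := by
  split_ifs with h
  · subst h
    rw [Function.update_self]
    congr 1
    refine Finset.prod_congr rfl fun l hl => ?_
    rw [Function.update_of_ne (Finset.ne_of_mem_erase hl)]
  · rw [Function.update_of_ne (Ne.symm h),
      ← Finset.mul_prod_erase _ _ (Finset.mem_erase.2 ⟨h, Finset.mem_univ i⟩),
      Function.update_self]
    congr 2
    refine Finset.prod_congr rfl fun l hl => ?_
    rw [Function.update_of_ne (Finset.ne_of_mem_erase hl)]

/-- The multilinear map `(x₁, …, x_k) ↦ (∏_{i ≠ j} φ(x_i)) • x_j`, which induces the linear map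
`φ^{⊗(j-1)} ⊗ Id ⊗ φ^{⊗(k-j)}` on the tensor power. -/
noncomputable def slot (φ : Dual ℝ V) {k : ℕ} (j : Fin k) :
    MultilinearMap ℝ (fun _ : Fin k => V) V where
  toFun x := (∏ i ∈ Finset.univ.erase j, φ (x i)) • x j
  map_update_add' := by
    intro hdec x i u v
    obtain rfl : hdec = instDecidableEqFin k := Subsingleton.elim _ _
    simp only [slot_aux]
    split_ifs
    · rw [smul_add]
    · rw [map_add, add_mul, add_smul]
  map_update_smul' := by
    intro hdec x i c v
    obtain rfl : hdec = instDecidableEqFin k := Subsingleton.elim _ _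
    simp only [slot_aux]
    split_ifs
    · rw [smul_comm]
    · rw [map_smul, smul_eq_mul, mul_assoc, mul_smul]

/-- The `k`th reduction map
`γ_k = (1/k) ∑_j φ^{⊗(j-1)} ⊗ Id ⊗ φ^{⊗(k-j)} : V^{⊗k} → V`. -/
noncomputable def reduction (φ : Dual ℝ V) (k : ℕ) : (⨂[ℝ]^k V) →ₗ[ℝ] V :=
  (1 / (k : ℝ)) • ∑ j : Fin k, PiTensorProduct.lift (slot φ j)

end Algebra

end ConeMonogamy

namespace ConeMonogamy

open Module

/-! ### Moments of product-type sums over outcome strings. -/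

section Moments

variable {M N ι : Type*} [AddCommGroup M] [Module ℝ M] [AddCommGroup N] [Module ℝ N] [Fintype ι]
  {k : ℕ}

/-! One inclusion is explicit: `x ⊗ y` with `y ≠ 0` is the reduction of `x ⊗ y^{⊗k} / φ(y)^(k-1)`.

The other is a de Finetti argument. If `z` lies outside the minimal tensor product, compactness
gives a separating functional `w` that is strictly positive on products of nonzero cone elements and
negative at `z`. Strictness leaves room to replace `C_B` by a slightly larger polyhedral cone, cut
out by forms `e i` of the dual cone with sum `φ` (`exists_measurement`). Measuring a `k`-fold
extension of `z` with the `e i` attaches to every outcome string `s` an element `Θ(e ∘ s)` of `C_A`,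
and the reduction map says exactly that `w z` is the sum over `s` of `w (Θ(e ∘ s) ⊗ L (empirical
s))`, where `L` inverts `y ↦ (e i y)` on its range.

An empirical distribution need not lie in that range, so a term may be negative, but only up to a
quadratic penalty in its distance from the range (`exists_measurement_penalty`). By a law of large
numbers (`sum_mul_sq_mean_le`) the total penalty is `O(1/k)`, so `w z ≥ 0`, a contradiction. -/

lemma sum_prod_smul_comp (Λ : MultilinearMap ℝ (fun _ : Fin k => M) N) (e : ι → M)
    (c : Fin k → ι → ℝ) :
    ∑ s : Fin k → ι, (∏ l, c l (s l)) • Λ (fun l => e (s l)) = Λ fun l => ∑ i, c l i • e i := by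
  classical
  rw [MultilinearMap.map_sum]
  exact Finset.sum_congr rfl fun s _ => (MultilinearMap.map_smul_univ Λ _ _).symm

lemma sum_smul_comp (Λ : MultilinearMap ℝ (fun _ : Fin k => M) N) (e : ι → M) (a : ι → ℝ)
    (j : Fin k) :
    ∑ s : Fin k → ι, a (s j) • Λ (fun l => e (s l)) =
      Λ (Function.update (fun _ => ∑ i, e i) j (∑ i, a i • e i)) := by
  have h := sum_prod_smul_comp Λ e (Function.update (fun _ _ => 1) j a)
  have h1 : ∀ s : Fin k → ι, ∏ l, Function.update (fun _ _ => (1 : ℝ)) j a l (s l) = a (s j) := by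
    intro s
    rw [Finset.prod_eq_single j]
    · simp
    · intro l _ hl
      simp [hl]
    · simp
  simp only [h1] at h
  rw [h]
  congr 1
  ext l
  by_cases hl : l = j
  · subst hl
    simp
  · simp [hl]

/-- Distinct positions are uncorrelated: summing over the index at position `j` puts `∑ aᵢ eᵢ = 0`
in that argument. -/
lemma sum_mul_smul_comp_eq_zero (Λ : MultilinearMap ℝ (fun _ : Fin k => M) N) (e : ι → M)
    {a : ι → ℝ} (ha : ∑ i, a i • e i = 0) {j j' : Fin k} (hj : j ≠ j') :
    ∑ s : Fin k → ι, (a (s j) * a (s j')) • Λ (fun l => e (s l)) = 0 := by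
  have h := sum_prod_smul_comp Λ e
    (Function.update (Function.update (fun _ _ => 1) j' a) j a)
  have h1 : ∀ s : Fin k → ι,
      ∏ l, Function.update (Function.update (fun _ _ => (1 : ℝ)) j' a) j a l (s l) =
        a (s j) * a (s j') := by
    intro s
    rw [← Finset.mul_prod_erase _ _ (Finset.mem_univ j), Function.update_self]
    congr 1
    rw [Finset.prod_eq_single j']
    · simp [hj.symm]
    · intro l hl hl'
      simp [Finset.ne_of_mem_erase hl, hl']
    · simp [hj.symm]
  simp only [h1] at h
  rw [h]
  exact Λ.map_coord_zero j (by simp [ha])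

/-- The law of large numbers for the empirical mean of `a`, when the relation `∑ aᵢ eᵢ = 0`
holds. -/
lemma sum_mul_sq_mean_le (Λ : MultilinearMap ℝ (fun _ : Fin k => M) ℝ) (hk : 1 ≤ k) (e : ι → M)
    (hΛ : ∀ s : Fin k → ι, 0 ≤ Λ (fun l => e (s l))) {a : ι → ℝ} (ha : ∑ i, a i • e i = 0)
    {A : ℝ} (hA : ∀ i, a i ^ 2 ≤ A) :
    ∑ s : Fin k → ι, Λ (fun l => e (s l)) * (1 / (k : ℝ) * ∑ j, a (s j)) ^ 2 ≤
      A * Λ (fun _ => ∑ i, e i) / k := by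
  have hk0 : (0 : ℝ) < k := by exact_mod_cast hk
  have h1 : ∀ s : Fin k → ι, Λ (fun l => e (s l)) * (1 / (k : ℝ) * ∑ j, a (s j)) ^ 2 =
      (1 / (k : ℝ)) ^ 2 * ∑ j, ∑ j', (a (s j) * a (s j')) • Λ (fun l => e (s l)) := by
    intro s
    rw [mul_pow, sq (∑ j, a (s j)), Finset.sum_mul_sum]
    simp only [smul_eq_mul, ← Finset.sum_mul]
    ring
  have h2 : ∀ j : Fin k, ∑ s : Fin k → ι, ∑ j', (a (s j) * a (s j')) • Λ (fun l => e (s l)) ≤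
      A * Λ (fun _ => ∑ i, e i) := by
    intro j
    -- Only the `k` diagonal terms out of `k²` survive, which leaves a factor `1/k`.
    rw [Finset.sum_comm, Finset.sum_eq_single j]
    · have h3 := sum_prod_smul_comp Λ e (fun _ _ => 1)
      simp only [Finset.prod_const_one, one_smul] at h3
      rw [← h3, Finset.mul_sum]
      refine Finset.sum_le_sum fun s _ => ?_
      rw [smul_eq_mul, ← sq]
      exact mul_le_mul_of_nonneg_right (hA _) (hΛ s)
    · intro j' _ hj
      exact sum_mul_smul_comp_eq_zero Λ e ha hj.symm
    · simp
  simp only [h1]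
  rw [← Finset.mul_sum, Finset.sum_comm]
  calc (1 / (k : ℝ)) ^ 2 * ∑ j : Fin k, ∑ s : Fin k → ι, ∑ j' : Fin k,
        (a (s j) * a (s j')) • Λ (fun l => e (s l))
      ≤ (1 / (k : ℝ)) ^ 2 * ∑ _j : Fin k, A * Λ (fun _ => ∑ i, e i) := by
        gcongr with j
        exact h2 j
    _ = A * Λ (fun _ => ∑ i, e i) / k := by
        simp
        field_simp

/-- The empirical distribution of a finite sequence. -/
noncomputable def empirical [DecidableEq ι] (s : Fin k → ι) (i : ι) : ℝ :=
  1 / (k : ℝ) * ∑ j, if s j = i then 1 else 0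

lemma sum_mul_empirical [DecidableEq ι] (s : Fin k → ι) (a : ι → ℝ) :
    ∑ i, a i * empirical s i = 1 / (k : ℝ) * ∑ j, a (s j) := by
  simp only [empirical, Finset.mul_sum]
  rw [Finset.sum_comm]
  refine Finset.sum_congr rfl fun j _ => ?_
  simp [mul_comm]

lemma empirical_mem_stdSimplex [DecidableEq ι] (hk : 1 ≤ k) (s : Fin k → ι) :
    empirical s ∈ stdSimplex ℝ ι := by
  have hk0 : (k : ℝ) ≠ 0 := by
    have : k ≠ 0 := by omega
    exact_mod_cast this
  refine ⟨fun i => ?_, ?_⟩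
  · refine mul_nonneg (by positivity) (Finset.sum_nonneg fun j _ => ?_)
    split_ifs <;> norm_num
  · have := sum_mul_empirical s (fun _ => 1)
    simpa [hk0] using this

/-- Averaging the empirical distribution reproduces the average over positions in the reduction map.
-/
lemma sum_empirical_smul_comp [DecidableEq ι] (Λ : MultilinearMap ℝ (fun _ : Fin k => M) N)
    (e : ι → M) (i : ι) :
    ∑ s : Fin k → ι, empirical s i • Λ (fun l => e (s l)) =
      (1 / (k : ℝ)) • ∑ j, Λ (Function.update (fun _ => ∑ i, e i) j (e i)) := by
  simp only [empirical, mul_smul, ← Finset.smul_sum, Finset.sum_smul]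
  rw [Finset.sum_comm]
  congr 1
  refine Finset.sum_congr rfl fun j _ => ?_
  rw [sum_smul_comp Λ e (fun i' => if i' = i then 1 else 0) j]
  simp

end Moments

/-- An exact penalty on a compact set. -/
lemma exists_penalty {X : Type*} [TopologicalSpace X] {K : Set X} (hK : IsCompact K)
    {F G : X → ℝ} (hF : Continuous F) (hG : Continuous G) (hG0 : ∀ x ∈ K, 0 ≤ G x)
    (h : ∀ x ∈ K, G x = 0 → 0 < F x) : ∃ c : ℝ, 0 ≤ c ∧ ∀ x ∈ K, 0 ≤ F x + c * G x := by
  obtain ⟨t, ht⟩ := hK.elim_finite_subcover (fun n : ℕ => {x | 0 < F x + n * G x})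
    (fun n => isOpen_lt continuous_const (by fun_prop)) (by
      intro x hx
      rw [Set.mem_iUnion]
      rcases (hG0 x hx).eq_or_lt with h0 | h0
      · exact ⟨0, by simpa using h x hx h0.symm⟩
      · obtain ⟨n, hn⟩ := exists_nat_gt (-F x / G x)
        rw [div_lt_iff₀ h0] at hn
        exact ⟨n, by simp only [Set.mem_ofPred_eq]; linarith⟩)
  -- The sum serves as an upper bound for every `n ∈ t`.
  refine ⟨∑ n ∈ t, (n : ℝ), by positivity, fun x hx => ?_⟩
  obtain ⟨n, hn, hx'⟩ := Set.mem_iUnion₂.1 (ht hx)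
  have h1 : (n : ℝ) ≤ ∑ n ∈ t, (n : ℝ) :=
    Finset.single_le_sum (f := fun n : ℕ => (n : ℝ)) (fun _ _ => by positivity) hn
  have h2 := mul_le_mul_of_nonneg_right h1 (hG0 x hx)
  simp only [Set.mem_ofPred_eq] at hx'
  linarith

/-! ### Convex separation and polyhedral approximation of cones. -/

section Separation

variable {E : Type*} [NormedAddCommGroup E] [NormedSpace ℝ E]

lemma exists_dualCone_neg {C : PointedCone ℝ E} (hC : IsClosed (C : Set E)) {x : E} (hx : x ∉ C) :
    ∃ f ∈ dualCone C, f x < 0 := by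
  let C' : ProperCone ℝ E := ⟨C, hC⟩
  obtain ⟨f, hf, hfx⟩ := ProperCone.hyperplane_separation_point C' (x₀ := x) hx
  exact ⟨f, hf, hfx⟩

lemma exists_unit_of_mem {C : PointedCone ℝ E} {x : E} (hx : x ∈ C) (hx0 : x ≠ 0) :
    ∃ u ∈ (C : Set E) ∩ Metric.sphere 0 1, ∃ r : ℝ, 0 < r ∧ x = r • u := by
  have hn : 0 < ‖x‖ := norm_pos_iff.2 hx0
  refine ⟨‖x‖⁻¹ • x, ⟨PointedCone.smul_mem _ (inv_nonneg.2 hn.le) hx, ?_⟩, ‖x‖, hn, ?_⟩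
  · simp [norm_smul, hn.ne']
  · rw [smul_inv_smul₀ hn.ne']

lemma exists_sub_smul_mem_dualCone {C : PointedCone ℝ E} {φ : StrongDual ℝ E}
    (hφ : φ ∈ interior (dualCone C)) (g : StrongDual ℝ E) :
    ∃ δ : ℝ, 0 < δ ∧ φ - δ • g ∈ dualCone C := by
  have h : Filter.Tendsto (fun δ : ℝ => φ - δ • g) (nhdsWithin 0 (Set.Ioi 0)) (nhds φ) := by
    have : Continuous fun δ : ℝ => φ - δ • g := by fun_prop
    simpa using (this.tendsto 0).mono_left nhdsWithin_le_nhds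
  have h1 := h.eventually (mem_interior_iff_mem_nhds.1 hφ)
  obtain ⟨δ, hδ, hδ'⟩ := (h1.and self_mem_nhdsWithin).exists
  exact ⟨δ, hδ', hδ⟩

lemma pos_of_mem_interior_dualCone {C : PointedCone ℝ E} {φ : StrongDual ℝ E}
    (hφ : φ ∈ interior (dualCone C)) {y : E} (hy : y ∈ C) (hy0 : y ≠ 0) : 0 < φ y := by
  obtain ⟨g, hg⟩ := geometric_hahn_banach_point_point hy0.symm
  rw [map_zero] at hg
  obtain ⟨δ, hδ, h⟩ := exists_sub_smul_mem_dualCone hφ g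
  have := h y hy
  simp only [sub_apply, smul_apply, smul_eq_mul] at this
  have := mul_pos hδ hg
  linarith

variable [FiniteDimensional ℝ E]

/-- By Carathéodory, boundedly many points suffice, so the hull is a finite union of continuous
images of compact sets. -/
lemma isCompact_convexHull {T : Set E} (hT : IsCompact T) : IsCompact (convexHull ℝ T) := by
  let n := finrank ℝ E + 1
  have key : convexHull ℝ T = ⋃ m ∈ Finset.range (n + 1),
      (fun p : (Fin m → ℝ) × (Fin m → E) => ∑ i, p.1 i • p.2 i) ''
        (stdSimplex ℝ (Fin m) ×ˢ Set.univ.pi fun _ => T) := by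
    apply Set.Subset.antisymm
    · intro x hx
      obtain ⟨ι, hι, z, w, hz, hai, hw, hw1, hx⟩ := eq_pos_convex_span_of_mem_convexHull hx
      have hc : Fintype.card ι ≤ n := hai.card_le_finrank_succ.trans
        (Nat.succ_le_succ (Submodule.finrank_le _))
      let f := Fintype.equivFin ι
      simp only [Set.mem_iUnion]
      refine ⟨Fintype.card ι, Finset.mem_range.2 (by omega), (w ∘ f.symm, z ∘ f.symm),
        ⟨⟨fun i => (hw _).le, ?_⟩, fun i _ => hz ⟨_, rfl⟩⟩, ?_⟩
      · rw [← hw1]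
        exact f.symm.sum_comp w
      · rw [← hx]
        exact f.symm.sum_comp fun i => w i • z i
    · simp only [Set.iUnion_subset_iff]
      rintro m - _ ⟨⟨w, z⟩, ⟨hw, hz⟩, rfl⟩
      exact (convex_convexHull ℝ T).sum_mem (fun i _ => hw.1 i) hw.2
        fun i _ => subset_convexHull ℝ T (hz i trivial)
  rw [key]
  refine Finset.isCompact_biUnion _ fun m _ => ?_
  refine ((isCompact_stdSimplex ℝ (Fin m)).prod (isCompact_univ_pi fun _ => hT)).image ?_
  fun_prop

lemma exists_pos_neg_of_notMem_hull {S : Set E} (hS : IsCompact S) (ω : StrongDual ℝ E)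
    (hω : ∀ s ∈ S, 0 < ω s) {z : E} (hz : z ∉ PointedCone.hull ℝ S) :
    ∃ f : StrongDual ℝ E, (∀ s ∈ S, 0 < f s) ∧ f z < 0 := by
  rcases le_or_gt (ω z) 0 with hc | hc
  · have hz0 : z ≠ 0 := by
      rintro rfl
      exact hz (Submodule.zero_mem _)
    obtain ⟨f, hf⟩ := geometric_hahn_banach_point_point hz0
    rw [map_zero] at hf
    rcases S.eq_empty_or_nonempty with rfl | hne
    · exact ⟨f, by simp, hf⟩
    obtain ⟨s₁, hs₁, h₁⟩ := hS.exists_isMinOn hne ω.continuous.continuousOn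
    obtain ⟨s₂, hs₂, h₂⟩ := hS.exists_isMinOn hne f.continuous.continuousOn
    have hd := hω s₁ hs₁
    -- The coefficient makes the multiple of `ω` at least `|f s₂| + 1` on `S`, which beats the
    -- minimum `f s₂`; at `z` it only helps, since `ω z ≤ 0`.
    refine ⟨f + ((|f s₂| + 1) / ω s₁) • ω, fun s hs => ?_, ?_⟩
    · have e₁ : ω s₁ ≤ ω s := h₁ hs
      have e₂ : f s₂ ≤ f s := h₂ hs
      have e₃ : |f s₂| + 1 ≤ (|f s₂| + 1) / ω s₁ * ω s := by
        rw [div_mul_eq_mul_div, le_div_iff₀ hd]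
        exact mul_le_mul_of_nonneg_left e₁ (by positivity)
      have e₄ := neg_abs_le (f s₂)
      simp only [add_apply, smul_apply, smul_eq_mul]
      linarith
    · have : (|f s₂| + 1) / ω s₁ * ω z ≤ 0 := mul_nonpos_of_nonneg_of_nonpos (by positivity) hc
      simp only [add_apply, smul_apply, smul_eq_mul]
      linarith
  -- Normalise to the slice `ω = 1`; subtracting `u • ω` then turns affine separation at level `u`
  -- into separation at level `0`.
  · let T : Set E := (fun s => (ω s)⁻¹ • s) '' S
    have hT : IsCompact T := hS.image_of_continuousOn <|
      (ω.continuous.continuousOn.inv₀ fun s hs => (hω s hs).ne').smul continuousOn_id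
    have hTS : convexHull ℝ T ⊆ PointedCone.hull ℝ S := by
      refine convexHull_min ?_ (PointedCone.convex _)
      rintro _ ⟨s, hs, rfl⟩
      exact PointedCone.smul_mem _ (inv_nonneg.2 (hω s hs).le) (PointedCone.subset_hull hs)
    have hz' : (ω z)⁻¹ • z ∉ convexHull ℝ T := by
      intro h
      have := PointedCone.smul_mem _ hc.le (hTS h)
      rw [smul_inv_smul₀ hc.ne'] at this
      exact hz this
    obtain ⟨f, u, hu, hf⟩ := geometric_hahn_banach_point_closed (convex_convexHull ℝ T)
      (isCompact_convexHull hT).isClosed hz'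
    refine ⟨f - u • ω, fun s hs => ?_, ?_⟩
    · have h := hf _ (subset_convexHull ℝ T ⟨s, hs, rfl⟩)
      simp only [map_smul, smul_eq_mul] at h
      rw [← div_eq_inv_mul, lt_div_iff₀ (hω s hs)] at h
      simpa using h
    · simp only [map_smul, smul_eq_mul] at hu
      rw [← div_eq_inv_mul, div_lt_iff₀ hc] at hu
      simpa using hu

lemma isCompact_inter_sphere {C : PointedCone ℝ E} (hC : IsClosed (C : Set E)) :
    IsCompact ((C : Set E) ∩ Metric.sphere 0 1) :=
  (isCompact_sphere 0 1).inter_left hC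

/-- Each unit vector of `C` is detected by some dual form, because its negative is not in `C`;
finitely many forms suffice by compactness, and their sum works. -/
lemma exists_strictly_positive {C : PointedCone ℝ E} (hC : IsProper C) :
    ∃ ψ : StrongDual ℝ E, ∀ x ∈ C, x ≠ 0 → 0 < ψ x := by
  obtain ⟨t, ht⟩ := (isCompact_inter_sphere hC.isClosed).elim_finite_subcover
    (fun f : dualCone C => {x : E | 0 < f.1 x})
    (fun f => isOpen_lt continuous_const f.1.continuous) (by
      rintro x ⟨hx, hx1⟩
      have hneg : -x ∉ C := fun h => Metric.ne_of_mem_sphere hx1 one_ne_zero (hC.no_line x hx h)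
      obtain ⟨f, hf, hfx⟩ := exists_dualCone_neg hC.isClosed hneg
      exact Set.mem_iUnion.2 ⟨⟨f, hf⟩, by simpa using hfx⟩)
  refine ⟨∑ f ∈ t, f.1, fun x hx hx0 => ?_⟩
  obtain ⟨u, hu, r, hr, rfl⟩ := exists_unit_of_mem hx hx0
  rw [map_smul, smul_eq_mul]
  refine mul_pos hr ?_
  obtain ⟨f, hft, hfu⟩ := Set.mem_iUnion₂.1 (ht hu)
  rw [sum_apply]
  exact Finset.sum_pos' (fun g _ => g.2 u hu.1) ⟨f, hft, hfu⟩

/-- A cone is approximated from outside by polyhedral cones: the cone cut out by finitely many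
positive forms summing to `φ` meets the unit sphere within any given open neighbourhood. -/
lemma exists_measurement {C : PointedCone ℝ E} (hC : IsClosed (C : Set E)) {φ : StrongDual ℝ E}
    (hφ : φ ∈ interior (dualCone C)) {U : Set E} (hU : IsOpen U)
    (hCU : (C : Set E) ∩ Metric.sphere 0 1 ⊆ U) :
    ∃ (n : ℕ) (e : Fin n → StrongDual ℝ E), (∀ i, e i ∈ dualCone C) ∧ ∑ i, e i = φ ∧
      ∀ y ∈ Metric.sphere (0 : E) 1, (∀ i, 0 ≤ e i y) → y ∈ U := by
  have hK : IsCompact (Metric.sphere (0 : E) 1 \ U) := (isCompact_sphere 0 1).diff hU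
  obtain ⟨t, ht⟩ := hK.elim_finite_subcover
    (fun f : dualCone C => {x : E | f.1 x < 0})
    (fun f => isOpen_lt f.1.continuous continuous_const) (by
      rintro x ⟨hx1, hxU⟩
      have hx : x ∉ C := fun h => hxU (hCU ⟨h, hx1⟩)
      obtain ⟨f, hf, hfx⟩ := exists_dualCone_neg hC hx
      exact Set.mem_iUnion.2 ⟨⟨f, hf⟩, hfx⟩)
  obtain ⟨δ, hδ, hmem⟩ := exists_sub_smul_mem_dualCone hφ (∑ f ∈ t, f.1)
  let m := t.equivFin
  -- The extra outcome is the remainder that makes the total `φ`; it is positive because `φ` is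
  -- interior and `δ` small.
  refine ⟨t.card + 1, Fin.cons (φ - δ • ∑ f ∈ t, f.1) fun i => δ • (m.symm i).1.1, ?_, ?_, ?_⟩
  · refine Fin.cases hmem fun i x hx => ?_
    simpa using mul_nonneg hδ.le ((m.symm i).1.2 x hx)
  · have h : ∑ i, δ • (m.symm i).1.1 = δ • ∑ f ∈ t, f.1 := by
      rw [← Finset.smul_sum, m.symm.sum_comp fun f => f.1.1, Finset.sum_coe_sort t fun f => f.1]
    rw [Fin.sum_univ_succ]
    simp only [Fin.cons_zero, Fin.cons_succ, h, sub_add_cancel]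
  · intro y hy hpos
    by_contra hyU
    obtain ⟨f, hft, hfy⟩ := Set.mem_iUnion₂.1 (ht ⟨hy, hyU⟩)
    have h := hpos (m ⟨f, hft⟩).succ
    simp only [Fin.cons_succ, Equiv.symm_apply_apply, smul_apply,
      smul_eq_mul] at h
    exact absurd hfy (not_lt.2 (nonneg_of_mul_nonneg_right h hδ))

end Separation

/-! ### Partial evaluation of tensors and the reduction map. -/

section Slices

variable {V W X : Type*} [AddCommGroup V] [Module ℝ V] [AddCommGroup W] [Module ℝ W]
  [AddCommGroup X] [Module ℝ X]

/-- The slice map `g ↦ Id ⊗ g`. -/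
noncomputable def slice : Dual ℝ W →ₗ[ℝ] (V ⊗[ℝ] W) →ₗ[ℝ] V :=
  LinearMap.compRight ℝ (TensorProduct.rid ℝ V).toLinearMap ∘ₗ LinearMap.lTensorHom V

@[simp]
lemma slice_tmul (g : Dual ℝ W) (x : V) (y : W) : slice g (x ⊗ₜ[ℝ] y) = g y • x := by
  simp [slice]

lemma slice_map (g : Dual ℝ X) (T : W →ₗ[ℝ] X) (z : V ⊗[ℝ] W) :
    slice g (TensorProduct.map LinearMap.id T z) = slice (g ∘ₗ T) z := by
  have h : slice g ∘ₗ TensorProduct.map LinearMap.id T = slice (V := V) (g ∘ₗ T) :=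
    TensorProduct.ext' fun x y => by simp
  exact LinearMap.congr_fun h z

lemma dual_slice (f : Dual ℝ V) (g : Dual ℝ W) (z : V ⊗[ℝ] W) :
    f (slice g z) = TensorProduct.dualDistrib ℝ V W (f ⊗ₜ g) z := by
  have h : f ∘ₗ slice g = TensorProduct.dualDistrib ℝ V W (f ⊗ₜ g) :=
    TensorProduct.ext' fun x y => by simp [mul_comm]
  exact LinearMap.congr_fun h z

lemma apply_eq_sum_slice {ι : Type*} [Fintype ι] (e : ι → Dual ℝ W) (b : ι → W)
    (hb : ∀ y, ∑ i, e i y • b i = y) (w : Dual ℝ (V ⊗[ℝ] W)) (z : V ⊗[ℝ] W) :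
    w z = ∑ i, w (slice (e i) z ⊗ₜ b i) := by
  have h : w = ∑ i, w ∘ₗ (TensorProduct.mk ℝ V W).flip (b i) ∘ₗ slice (e i) := by
    refine TensorProduct.ext' fun x y => ?_
    conv_lhs => rw [← hb y]
    simp [TensorProduct.tmul_sum, TensorProduct.smul_tmul']
  conv_lhs => rw [h]
  simp

/-- The multilinear map `g ↦ (Id ⊗ g₁ ⊗ ⋯ ⊗ g_k) z`. -/
noncomputable def multislice {k : ℕ} (z : V ⊗[ℝ] (⨂[ℝ]^k W)) :
    MultilinearMap ℝ (fun _ : Fin k => Dual ℝ W) V :=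
  (LinearMap.applyₗ z ∘ₗ slice ∘ₗ PiTensorProduct.dualDistrib).compMultilinearMap
    (PiTensorProduct.tprod ℝ)

lemma multislice_apply {k : ℕ} (z : V ⊗[ℝ] (⨂[ℝ]^k W)) (g : Fin k → Dual ℝ W) :
    multislice z g = slice (PiTensorProduct.dualDistrib (PiTensorProduct.tprod ℝ g)) z := rfl

lemma comp_reduction (φ g : Dual ℝ W) (k : ℕ) :
    g ∘ₗ reduction φ k = (1 / (k : ℝ)) • ∑ j : Fin k,
      PiTensorProduct.dualDistrib (PiTensorProduct.tprod ℝ (Function.update (fun _ => φ) j g)) := by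
  refine PiTensorProduct.ext (MultilinearMap.ext fun x => ?_)
  simp only [reduction, LinearMap.compMultilinearMap_apply, LinearMap.comp_apply,
    LinearMap.smul_apply, LinearMap.sum_apply, map_smul, map_sum, PiTensorProduct.lift.tprod,
    PiTensorProduct.dualDistrib_apply]
  congr 1
  refine Finset.sum_congr rfl fun j _ => ?_
  rw [← Finset.mul_prod_erase _ _ (Finset.mem_univ j), Function.update_self]
  have h : ∏ i ∈ Finset.univ.erase j, (Function.update (fun _ => φ) j g i) (x i) =
      ∏ i ∈ Finset.univ.erase j, φ (x i) :=
    Finset.prod_congr rfl fun i hi => by rw [Function.update_of_ne (Finset.ne_of_mem_erase hi)]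
  rw [h, mul_comm]
  change g ((∏ i ∈ Finset.univ.erase j, φ (x i)) • x j) = _
  rw [map_smul, smul_eq_mul]

lemma slice_map_reduction (φ g : Dual ℝ W) {k : ℕ} (z : V ⊗[ℝ] (⨂[ℝ]^k W)) :
    slice g (TensorProduct.map LinearMap.id (reduction φ k) z) =
      (1 / (k : ℝ)) • ∑ j : Fin k, multislice z (Function.update (fun _ => φ) j g) := by
  simp only [slice_map, comp_reduction, map_smul, map_sum, LinearMap.smul_apply,
    LinearMap.sum_apply, multislice_apply]

lemma reduction_tprod_const (φ : Dual ℝ W) {k : ℕ} (hk : 1 ≤ k) (y : W) :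
    reduction φ k (PiTensorProduct.tprod ℝ fun _ => y) = φ y ^ (k - 1) • y := by
  have hk0 : (k : ℝ) ≠ 0 := by
    have : k ≠ 0 := by omega
    exact_mod_cast this
  have h : ∀ j : Fin k, slot φ j (fun _ => y) = φ y ^ (k - 1) • y := fun j => by
    change (∏ i ∈ Finset.univ.erase j, φ y) • y = _
    simp
  simp only [reduction, LinearMap.smul_apply, LinearMap.sum_apply, PiTensorProduct.lift.tprod, h]
  rw [Finset.sum_const, Finset.card_univ, Fintype.card_fin, ← Nat.cast_smul_eq_nsmul ℝ, smul_smul,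
    one_div, inv_mul_cancel₀ hk0, one_smul]

lemma mem_maxPower {C : PointedCone ℝ W} {k : ℕ} {y : ⨂[ℝ]^k W} :
    y ∈ maxPower C k ↔ ∀ g : Fin k → Dual ℝ W, (∀ i, ∀ x ∈ C, 0 ≤ g i x) →
      0 ≤ PiTensorProduct.dualDistrib (PiTensorProduct.tprod ℝ g) y := by
  simp only [maxPower, minPower, PointedCone.dual_hull, PointedCone.mem_dual, Set.mem_ofPred_eq]
  refine ⟨fun h g hg => h ⟨g, hg, rfl⟩, ?_⟩
  rintro h _ ⟨g, hg, rfl⟩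
  exact h g hg

lemma tprod_mem_maxPower {C : PointedCone ℝ W} {k : ℕ} {y : Fin k → W} (hy : ∀ i, y i ∈ C) :
    PiTensorProduct.tprod ℝ y ∈ maxPower C k :=
  mem_maxPower.2 fun g hg => by
    rw [PiTensorProduct.dualDistrib_apply]
    exact Finset.prod_nonneg fun i _ => hg i _ (hy i)

lemma tmul_mem_image_reduction {CV : PointedCone ℝ V} {CW : PointedCone ℝ W} {φ : Dual ℝ W}
    (hφ : ∀ y ∈ CW, y ≠ 0 → 0 < φ y) {k : ℕ} (hk : 1 ≤ k) {x : V} (hx : x ∈ CV) {y : W}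
    (hy : y ∈ CW) :
    x ⊗ₜ[ℝ] y ∈ (PointedCone.maxTensorProduct CV (maxPower CW k)).map
      (TensorProduct.map (LinearMap.id : V →ₗ[ℝ] V) (reduction φ k)) := by
  rcases eq_or_ne y 0 with rfl | hy0
  · rw [TensorProduct.tmul_zero]
    exact Submodule.zero_mem _
  · have hp := pow_pos (hφ y hy hy0) (k - 1)
    refine ⟨x ⊗ₜ ((φ y ^ (k - 1))⁻¹ • PiTensorProduct.tprod ℝ fun _ => y),
      PointedCone.tmul_mem_maxTensorProduct hx (PointedCone.smul_mem _ (inv_nonneg.2 hp.le)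
        (tprod_mem_maxPower fun _ => hy)), ?_⟩
    change TensorProduct.map LinearMap.id (reduction φ k) _ = _
    rw [TensorProduct.map_tmul, map_smul, reduction_tprod_const φ hk, inv_smul_smul₀ hp.ne',
      LinearMap.id_apply]

end Slices

/-! ### The de Finetti argument and the strict separation from the minimal tensor product. -/

section Positivity

variable {V W : Type*} [NormedAddCommGroup V] [NormedSpace ℝ V]

lemma multislice_mem [AddCommGroup W] [Module ℝ W] {CV : PointedCone ℝ V}
    (hCV : IsClosed (CV : Set V)) {CW : PointedCone ℝ W} {k : ℕ} {z : V ⊗[ℝ] (⨂[ℝ]^k W)}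
    (hz : z ∈ PointedCone.maxTensorProduct CV (maxPower CW k)) {g : Fin k → Dual ℝ W}
    (hg : ∀ i, ∀ y ∈ CW, 0 ≤ g i y) : multislice z g ∈ CV := by
  by_contra h
  obtain ⟨f, hf, hneg⟩ := exists_dualCone_neg hCV h
  refine absurd hneg (not_lt.2 ?_)
  have := PointedCone.mem_maxTensorProduct.1 hz (f : V →ₗ[ℝ] ℝ) (fun x hx => hf x hx)
    (PiTensorProduct.dualDistrib (PiTensorProduct.tprod ℝ g))
    (fun y hy => mem_maxPower.1 hy g hg)
  rwa [← dual_slice] at this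

variable [FiniteDimensional ℝ V] [NormedAddCommGroup W] [NormedSpace ℝ W] [FiniteDimensional ℝ W]

lemma isOpen_forall_pos {K : Set V} (hK : IsCompact K) (B : V →ₗ[ℝ] W →ₗ[ℝ] ℝ) :
    IsOpen {y : W | ∀ x ∈ K, 0 < B x y} := by
  have hB : Continuous fun p : V × W => B p.1 p.2 := B.toContinuousBilinearMap.continuous₂
  rw [isOpen_iff_mem_nhds]
  intro y hy
  refine hK.eventually_forall_of_forall_eventually fun x hx => ?_
  have hc : Continuous fun p : W × V => B p.2 p.1 := hB.comp continuous_swap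
  exact hc.continuousAt.eventually (lt_mem_nhds (hy x hx))

/-- A functional that is strictly positive on a pair of cones is, up to a quadratic penalty,
nonnegative on outcome distributions of a suitable finite measurement. -/
lemma exists_measurement_penalty {CV : PointedCone ℝ V} (hCV : IsProper CV) {CW : PointedCone ℝ W}
    (hCW : IsClosed (CW : Set W)) {φ : StrongDual ℝ W} (hφ : φ ∈ interior (dualCone CW))
    (B : V →ₗ[ℝ] W →ₗ[ℝ] ℝ) (hB : ∀ x ∈ CV, x ≠ 0 → ∀ y ∈ CW, y ≠ 0 → 0 < B x y) :
    ∃ (n : ℕ) (e : Fin n → Dual ℝ W) (L : (Fin n → ℝ) →ₗ[ℝ] W) (ψ : Dual ℝ V) (c : ℝ),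
      (∀ i, ∀ y ∈ CW, 0 ≤ e i y) ∧ ∑ i, e i = (φ : W →ₗ[ℝ] ℝ) ∧
      (∀ y, L (LinearMap.pi e y) = y) ∧ (∀ x ∈ CV, 0 ≤ ψ x) ∧ 0 ≤ c ∧
      ∀ x ∈ CV, ∀ t ∈ stdSimplex ℝ (Fin n),
        0 ≤ B x (L t) + c * (ψ x * ∑ r, (t r - e r (L t)) ^ 2) := by
  have hK := isCompact_inter_sphere hCV.isClosed
  obtain ⟨n, e, he, hsum, hU⟩ := exists_measurement hCW hφ
    -- The condition `0 < φ y` forces the polyhedral cone to contain no line, hence the `e i` to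
    -- separate points.
    (U := {y | 0 < φ y} ∩ {y | ∀ x ∈ (CV : Set V) ∩ Metric.sphere 0 1, 0 < B x y})
    ((isOpen_lt continuous_const φ.continuous).inter (isOpen_forall_pos hK B)) (by
      rintro y ⟨hy, hy1⟩
      have hy0 := Metric.ne_of_mem_sphere hy1 one_ne_zero
      exact ⟨pos_of_mem_interior_dualCone hφ hy hy0, fun x hx =>
        hB x hx.1 (Metric.ne_of_mem_sphere hx.2 one_ne_zero) y hy hy0⟩)
  have hU' : ∀ y, y ≠ 0 → (∀ i, 0 ≤ e i y) → 0 < φ y ∧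
      ∀ x ∈ (CV : Set V) ∩ Metric.sphere 0 1, 0 < B x y := by
    intro y hy0 hy
    have hn : 0 < ‖y‖⁻¹ := inv_pos.2 (norm_pos_iff.2 hy0)
    obtain ⟨h₁, h₂⟩ := hU (‖y‖⁻¹ • y) (by simp [norm_smul, hy0]) fun i => by
      rw [map_smul]
      exact mul_nonneg hn.le (hy i)
    refine ⟨?_, fun x hx => ?_⟩
    · simp only [Set.mem_ofPred_eq, map_smul, smul_eq_mul] at h₁
      exact (mul_pos_iff_of_pos_left hn).1 h₁
    · have := h₂ x hx
      simp only [map_smul, smul_eq_mul] at this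
      exact (mul_pos_iff_of_pos_left hn).1 this
  let e' : Fin n → Dual ℝ W := fun i => (e i : W →ₗ[ℝ] ℝ)
  have hker : LinearMap.ker (LinearMap.pi e') = ⊥ := by
    rw [LinearMap.ker_eq_bot']
    intro y hy
    by_contra hy0
    have h : ∀ i, e i y = 0 := fun i => congrFun hy i
    have h₁ := (hU' y hy0 fun i => (h i).ge).1
    have h₂ := (hU' (-y) (neg_ne_zero.2 hy0) fun i => by simp [h i]).1
    rw [map_neg] at h₂
    linarith
  obtain ⟨L, hL⟩ := (LinearMap.pi e').exists_leftInverse_of_injective hker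
  obtain ⟨ψ, hψ⟩ := exists_strictly_positive hCV
  have hLc : Continuous L := L.continuous_of_finiteDimensional
  have hBc : Continuous fun p : V × W => B p.1 p.2 := B.toContinuousBilinearMap.continuous₂
  obtain ⟨c, hc, hpen⟩ := exists_penalty (hK.prod (isCompact_stdSimplex ℝ (Fin n)))
    (F := fun p => B p.1 (L p.2))
    (G := fun p => ψ p.1 * ∑ r, (p.2 r - e r (L p.2)) ^ 2)
    (hBc.comp (continuous_fst.prodMk (hLc.comp continuous_snd))) (by fun_prop)
    (fun p hp => mul_nonneg (hψ _ hp.1.1 (Metric.ne_of_mem_sphere hp.1.2 one_ne_zero)).le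
      (by positivity)) (by
      -- Zero penalty means that `t` is the outcome vector of `L t`, so `L t` lies in the polyhedral
      -- cone; it is nonzero because `t` sums to `1`.
      rintro ⟨x, t⟩ ⟨hx, ht⟩ h0
      have hx0 := Metric.ne_of_mem_sphere hx.2 one_ne_zero
      have h1 := (mul_eq_zero.1 h0).resolve_left (hψ x hx.1 hx0).ne'
      have h2 : ∀ r, e r (L t) = t r := fun r => by
        have := (Finset.sum_eq_zero_iff_of_nonneg fun _ _ => sq_nonneg _).1 h1 r
          (Finset.mem_univ r)
        have := pow_eq_zero_iff two_ne_zero |>.1 this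
        linarith
      refine (hU' (L t) (fun h => ?_) fun i => (h2 i).symm ▸ ht.1 i).2 x hx
      have h3 := ht.2
      simp [← h2, h] at h3)
  refine ⟨n, e', L, (ψ : V →ₗ[ℝ] ℝ), c, he, ?_, LinearMap.congr_fun hL, fun x hx => ?_, hc,
    fun x hx t ht => ?_⟩
  · ext y
    rw [← hsum]
    simp [e']
  · rcases eq_or_ne x 0 with rfl | hx0
    · simp
    · exact (hψ x hx hx0).le
  · rcases eq_or_ne x 0 with rfl | hx0
    · simp
    · obtain ⟨u, hu, r, hr, rfl⟩ := exists_unit_of_mem hx hx0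
      have := mul_nonneg hr.le (hpen (u, t) ⟨hu, ht⟩)
      rw [map_smul, map_smul, LinearMap.smul_apply, smul_eq_mul, smul_eq_mul]
      change 0 ≤ r * B u (L t) + c * (r * ψ u * ∑ r, (t r - e r (L t)) ^ 2)
      linarith [this, mul_add r (B u (L t)) (c * (ψ u * ∑ r, (t r - e r (L t)) ^ 2))]

/-- The de Finetti argument: a tensor with positive extensions of all orders is nonnegative under
every strictly positive functional. -/
lemma apply_nonneg_of_extendible {CV : PointedCone ℝ V} (hCV : IsProper CV) {CW : PointedCone ℝ W}
    (hCW : IsClosed (CW : Set W)) {φ : StrongDual ℝ W} (hφ : φ ∈ interior (dualCone CW))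
    (w : Dual ℝ (V ⊗[ℝ] W)) (hw : ∀ x ∈ CV, x ≠ 0 → ∀ y ∈ CW, y ≠ 0 → 0 < w (x ⊗ₜ y))
    {z : V ⊗[ℝ] W}
    (hz : ∀ k : ℕ, 1 ≤ k → ∃ Θ : MultilinearMap ℝ (fun _ : Fin k => Dual ℝ W) V,
      (∀ g : Fin k → Dual ℝ W, (∀ i, ∀ y ∈ CW, 0 ≤ g i y) → Θ g ∈ CV) ∧
      ∀ g : Dual ℝ W, slice g z =
        (1 / (k : ℝ)) • ∑ j, Θ (Function.update (fun _ => (φ : W →ₗ[ℝ] ℝ)) j g)) :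
    0 ≤ w z := by
  obtain ⟨n, e, L, ψ, c, he, hsum, hL, hψ, hc, hpen⟩ := exists_measurement_penalty hCV hCW hφ
    (TensorProduct.curry w) hw
  let δ : Fin n → Fin n → ℝ := fun i j => if i = j then 1 else 0
  -- `R r` is the `r`-th coordinate of the deviation from the range of the measurement. Vanishing on
  -- that range is exactly the relation among the `e i` that the law of large numbers needs.
  let R : Fin n → (Fin n → ℝ) →ₗ[ℝ] ℝ := fun r => LinearMap.proj r - e r ∘ₗ L
  have hR : ∀ r, ∑ i, R r (δ i) • e i = 0 := by
    intro r
    ext y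
    have h : R r (LinearMap.pi e y) = 0 := by simp [R, hL]
    rw [LinearMap.pi_apply_eq_sum_univ] at h
    rw [LinearMap.zero_apply, ← h, LinearMap.sum_apply]
    refine Finset.sum_congr rfl fun i _ => ?_
    simp only [LinearMap.smul_apply, smul_eq_mul, LinearMap.pi_apply]
    rw [mul_comm]
  let A : Fin n → ℝ := fun r => ∑ i, R r (δ i) ^ 2
  have hA : ∀ r i, R r (δ i) ^ 2 ≤ A r := fun r i =>
    Finset.single_le_sum (f := fun i => R r (δ i) ^ 2) (fun _ _ => sq_nonneg _) (Finset.mem_univ i)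
  have hbound : ∀ k : ℕ, 1 ≤ k →
      -(c * ∑ r, A r * ψ (slice (φ : W →ₗ[ℝ] ℝ) z)) ≤ w z * k := by
    intro k hk
    have hk0 : (0 : ℝ) < k := by exact_mod_cast hk
    obtain ⟨Θ, hΘ, hsl⟩ := hz k hk
    have hp : ∀ s : Fin k → Fin n, Θ (fun l => e (s l)) ∈ CV := fun s => hΘ _ fun l => he (s l)
    have hφz : Θ (fun _ => (φ : W →ₗ[ℝ] ℝ)) = slice (φ : W →ₗ[ℝ] ℝ) z := by
      rw [hsl]
      simp only [Function.update_eq_self, Finset.sum_const, Finset.card_univ, Fintype.card_fin]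
      rw [← Nat.cast_smul_eq_nsmul ℝ, smul_smul, one_div, inv_mul_cancel₀ hk0.ne', one_smul]
    have hwz : w z = ∑ s : Fin k → Fin n,
        TensorProduct.curry w (Θ (fun l => e (s l))) (L (empirical s)) := by
      rw [apply_eq_sum_slice e (fun i => L (δ i)) (fun y => by
        conv_rhs => rw [← hL y, LinearMap.pi_apply_eq_sum_univ]
        rfl) w z]
      have h1 : ∀ i, slice (e i) z = ∑ s : Fin k → Fin n, empirical s i • Θ (fun l => e (s l)) :=
        fun i => by rw [sum_empirical_smul_comp, hsum, hsl]
      have h2 : ∀ s : Fin k → Fin n, L (empirical s) = ∑ i, empirical s i • L (δ i) :=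
        fun s => LinearMap.pi_apply_eq_sum_univ L _
      simp only [h1, h2, TensorProduct.sum_tmul, map_sum, map_smul,
        ← TensorProduct.smul_tmul', TensorProduct.curry_apply]
      rw [Finset.sum_comm]
    have hmoment : ∀ r, ∑ s : Fin k → Fin n, ψ (Θ (fun l => e (s l))) * R r (empirical s) ^ 2 ≤
        A r * ψ (slice (φ : W →ₗ[ℝ] ℝ) z) / k := by
      intro r
      have h := sum_mul_sq_mean_le (ψ.compMultilinearMap Θ) hk e (fun s => hψ _ (hp s)) (hR r)
        (hA r)
      simp only [LinearMap.compMultilinearMap_apply, hsum, hφz] at h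
      refine le_trans (le_of_eq ?_) h
      refine Finset.sum_congr rfl fun s _ => ?_
      rw [← sum_mul_empirical s fun i => R r (δ i), LinearMap.pi_apply_eq_sum_univ (R r)]
      simp only [smul_eq_mul, δ, mul_comm]
    have hsum_nonneg : 0 ≤ w z + c * ∑ r, A r * ψ (slice (φ : W →ₗ[ℝ] ℝ) z) / k := by
      calc (0 : ℝ) ≤ ∑ s : Fin k → Fin n,
            (TensorProduct.curry w (Θ (fun l => e (s l))) (L (empirical s)) +
              c * (ψ (Θ (fun l => e (s l))) *
                ∑ r, (empirical s r - e r (L (empirical s))) ^ 2)) :=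
            Finset.sum_nonneg fun s _ => hpen _ (hp s) _ (empirical_mem_stdSimplex hk s)
        _ = w z + c * ∑ r, ∑ s : Fin k → Fin n,
              ψ (Θ (fun l => e (s l))) * R r (empirical s) ^ 2 := by
            rw [Finset.sum_add_distrib, ← hwz, ← Finset.mul_sum]
            simp only [Finset.mul_sum]
            rw [Finset.sum_comm]
            rfl
        _ ≤ _ := by
            gcongr with r
            exact hmoment r
    rw [← Finset.sum_div, mul_div_assoc', ← sub_neg_eq_add, ← neg_div, sub_nonneg,
      div_le_iff₀ hk0] at hsum_nonneg
    exact hsum_nonneg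
  by_contra! hneg
  obtain ⟨k, hk⟩ := exists_nat_gt
    ((c * ∑ r, A r * ψ (slice (φ : W →ₗ[ℝ] ℝ) z)) / -(w z))
  rw [div_lt_iff₀ (neg_pos.2 hneg)] at hk
  have := hbound (k + 1) (by omega)
  push_cast at this
  nlinarith

lemma exists_pos_neg_of_notMem_minTensorProduct {CV : PointedCone ℝ V} (hCV : IsProper CV)
    {CW : PointedCone ℝ W} (hCW : IsProper CW) {z : V ⊗[ℝ] W}
    (hz : z ∉ PointedCone.minTensorProduct CV CW) :
    ∃ w : Dual ℝ (V ⊗[ℝ] W),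
      (∀ x ∈ CV, x ≠ 0 → ∀ y ∈ CW, y ≠ 0 → 0 < w (x ⊗ₜ y)) ∧ w z < 0 := by
  obtain ⟨ψ, hψ⟩ := exists_strictly_positive hCV
  obtain ⟨χ, hχ⟩ := exists_strictly_positive hCW
  -- Coordinates supply the normed space in which the separation takes place.
  let b := (finBasis ℝ (V ⊗[ℝ] W)).equivFun
  let T : V →ₗ[ℝ] W →ₗ[ℝ] (Fin (finrank ℝ (V ⊗[ℝ] W)) → ℝ) :=
    (TensorProduct.mk ℝ V W).compr₂ b.toLinearMap
  have hT : Continuous fun p : V × W => T p.1 p.2 := T.toContinuousBilinearMap.continuous₂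
  have hS := ((isCompact_inter_sphere hCV.isClosed).prod
    (isCompact_inter_sphere hCW.isClosed)).image hT
  obtain ⟨f, hf, hfz⟩ := exists_pos_neg_of_notMem_hull hS
    (LinearMap.toContinuousLinearMap (TensorProduct.dualDistrib ℝ V W
      ((ψ : V →ₗ[ℝ] ℝ) ⊗ₜ (χ : W →ₗ[ℝ] ℝ)) ∘ₗ b.symm.toLinearMap)) (z := b z) (by
      rintro _ ⟨⟨x, y⟩, ⟨hx, hy⟩, rfl⟩
      have h₁ := hψ x hx.1 (Metric.ne_of_mem_sphere hx.2 one_ne_zero)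
      have h₂ := hχ y hy.1 (Metric.ne_of_mem_sphere hy.2 one_ne_zero)
      simpa [T] using mul_pos h₁ h₂) (by
      intro h
      have hle : PointedCone.hull ℝ ((fun p : V × W => T p.1 p.2) ''
          (((CV : Set V) ∩ Metric.sphere 0 1) ×ˢ ((CW : Set W) ∩ Metric.sphere 0 1))) ≤
          (PointedCone.minTensorProduct CV CW).comap b.symm.toLinearMap :=
        Submodule.span_le.2 (by
          rintro _ ⟨⟨x, y⟩, ⟨hx, hy⟩, rfl⟩
          have := PointedCone.tmul_mem_minTensorProduct hx.1 hy.1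
          simpa [T] using this)
      have := hle h
      simp only [PointedCone.mem_comap, LinearEquiv.coe_coe, LinearEquiv.symm_apply_apply] at this
      exact hz this)
  refine ⟨(f : _ →ₗ[ℝ] ℝ) ∘ₗ b.toLinearMap, fun x hx hx0 y hy hy0 => ?_, hfz⟩
  obtain ⟨u, hu, r, hr, rfl⟩ := exists_unit_of_mem hx hx0
  obtain ⟨v, hv, q, hq, rfl⟩ := exists_unit_of_mem hy hy0
  have h : 0 < f (b (u ⊗ₜ v)) := hf _ ⟨(u, v), ⟨hu, hv⟩, rfl⟩
  rw [TensorProduct.smul_tmul_smul, map_smul, smul_eq_mul]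
  exact mul_pos (mul_pos hr hq) h

end Positivity

end ConeMonogamy

theorem theorem1
    {VA : Type*} [NormedAddCommGroup VA] [NormedSpace ℝ VA] [FiniteDimensional ℝ VA]
    {VB : Type*} [NormedAddCommGroup VB] [NormedSpace ℝ VB] [FiniteDimensional ℝ VB]
    (CA : PointedCone ℝ VA) (hCA : ConeMonogamy.IsProper CA)
    (CB : PointedCone ℝ VB) (hCB : ConeMonogamy.IsProper CB)
    (φ : StrongDual ℝ VB) (hφ : φ ∈ interior (ConeMonogamy.dualCone CB)) :
    (PointedCone.minTensorProduct CA CB : Set (VA ⊗[ℝ] VB)) =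
      ⋂ (k : ℕ) (_ : 1 ≤ k),
        TensorProduct.map (LinearMap.id : VA →ₗ[ℝ] VA)
            (ConeMonogamy.reduction (φ : VB →ₗ[ℝ] ℝ) k) ''
          (PointedCone.maxTensorProduct CA (ConeMonogamy.maxPower CB k) :
            Set (VA ⊗[ℝ] (⨂[ℝ]^k VB))) := by
  apply Set.Subset.antisymm
  · refine Set.subset_iInter₂ fun k hk => ?_
    have h : PointedCone.minTensorProduct CA CB ≤
        (PointedCone.maxTensorProduct CA (ConeMonogamy.maxPower CB k)).map
          (TensorProduct.map LinearMap.id (ConeMonogamy.reduction (φ : VB →ₗ[ℝ] ℝ) k)) := by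
      refine Submodule.span_le.2 ?_
      rintro _ ⟨x, hx, y, hy, rfl⟩
      exact ConeMonogamy.tmul_mem_image_reduction
        (fun y hy hy0 => ConeMonogamy.pos_of_mem_interior_dualCone hφ hy hy0) hk hx hy
    exact h
  · intro z hz
    by_contra hmin
    obtain ⟨w, hw, hwz⟩ :=
      ConeMonogamy.exists_pos_neg_of_notMem_minTensorProduct hCA hCB hmin
    refine absurd hwz (not_lt.2
      (ConeMonogamy.apply_nonneg_of_extendible hCA hCB.isClosed hφ w hw fun k hk => ?_))
    obtain ⟨ζ, hζ, rfl⟩ := Set.mem_iInter₂.1 hz k hk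
    exact ⟨ConeMonogamy.multislice ζ,
      fun g hg => ConeMonogamy.multislice_mem hCA.isClosed hζ hg,
      fun g => ConeMonogamy.slice_map_reduction _ g ζ⟩
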